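/- Let $G=(V,E)$ be a finite connected plane graph: a finite connected graph, with loops and multiple edges allowed, that is cellularly embedded in the sphere. The embedding is given by its rotation system, i.e. the cyclic order of the half-edges around each vertex; its faces are bounded by the closed walks obtained by face tracing (for a single vertex without edges there is one face, whose boundary walk has no edges), and the embedding surface is the sphere exactly when $|V|-|E|+|F|=2$, where $F$ is the set of faces. Consider the following two moves on the edge bicolorings $E\to\{\text{blue},\text{red}\}$ of $G$. 1. Around a vertex, switch the colors of all edges with exactly one endpoint at that vertex (i.e. of all non-loops at the vertex). 2. Around a face of the embedded graph, switch the colors of all edges appearing exactly once in the boundary walk of the face. Call two colorings equivalent if one can be obtained from the other by a finite (possibly empty) sequence of these moves. Then this is an equivalence relation on the set of edge bicolorings of $G$, and the number of its equivalence classes is $|T_G(-1,-1)|$, the absolute value at $(-1,-1)$ of the Tutte polynomial $$T_G(x,y)=\sum_{A\subseteq E}(x-1)^{k(A)-k(E)}(y-1)^{|A|-|V|+k(A)},$$ where $k(A)$ is the number of connected components of the spanning subgraph $(V,A)$. -/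

import Mathlib

open scoped Graph

namespace Graph

universe u v

/-- The connected components of the multigraph `G`: the vertices of `G` modulo the equivalence
relation generated by adjacency. -/
def Component {α : Type u} {β : Type v} (G : Graph α β) : Type u :=
  Quot (fun x y : V(G) => G.Adj (x : α) (y : α))

/-- `k(G)`, the number of connected components of `G`. -/
noncomputable def numComponents {α : Type u} {β : Type v} (G : Graph α β) : ℕ :=
  Nat.card G.Component

/-- `G` is connected: it has a vertex, and any two vertices are joined by a walk. -/
def Connected {α : Type u} {β : Type v} (G : Graph α β) : Prop :=
  V(G).Nonempty ∧ ∀ x ∈ V(G), ∀ y ∈ V(G), Relation.ReflTransGen G.Adj x y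

/-- The Tutte polynomial of a multigraph with finitely many edges, in the variables
`x = X 0` and `y = X 1`:
`T_G(x, y) = ∑_{F ⊆ E(G)} (x - 1)^(k(F) - k(G)) (y - 1)^(|F| - |V(G)| + k(F))`,
where `k(F)` is the number of components of the spanning subgraph with edge set `F`.
For a finite graph `k(G) ≤ k(F)` and `|V(G)| ≤ |F| + k(F)`, so neither of the
subtractions of natural numbers is truncated. -/
noncomputable def tuttePolynomial {α : Type u} {β : Type v} (G : Graph α β)
    (hE : E(G).Finite) : MvPolynomial (Fin 2) ℤ :=
  ∑ F ∈ hE.toFinset.powerset,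
    (MvPolynomial.X 0 - 1) ^ ((G.restrict (F : Set β)).numComponents - G.numComponents) *
    (MvPolynomial.X 1 - 1) ^ (F.card + (G.restrict (F : Set β)).numComponents - V(G).ncard)

/-- A cellular embedding of the multigraph `G` in closed oriented surfaces (one for each
connected component of `G`), given by a rotation system.

Every edge `e`, loops included, consists of two half-edges `(e, false)` and `(e, true)`. The
vertex at which a half-edge `d` is attached is `vert d`, and `next d` is the half-edge
which follows `d` in the cyclic (counterclockwise) order of the half-edges around that vertex. -/
structure RotationSystem {α : Type u} {β : Type v} (G : Graph α β) where
  /-- The vertex at which a half-edge is attached. -/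
  vert : E(G) × Bool → V(G)
  /-- The two half-edges of `e` are attached at the two ends of `e`. -/
  isLink : ∀ e : E(G), G.IsLink (e : β) (vert (e, false) : α) (vert (e, true) : α)
  /-- The rotation. -/
  next : Equiv.Perm (E(G) × Bool)
  /-- The rotation permutes the half-edges at each vertex in a single cycle. -/
  sameCycle_next_iff : ∀ d d' : E(G) × Bool, next.SameCycle d d' ↔ vert d = vert d'

namespace RotationSystem

variable {α : Type u} {β : Type v} {G : Graph α β}

/-- The involution that exchanges the two half-edges of every edge. -/
def flip : Equiv.Perm (E(G) × Bool) :=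
  Equiv.prodCongr (Equiv.refl E(G)) Equiv.boolNot

/-- Face tracing. A half-edge `d` stands for the edge traversed starting from `vert d`. On
arrival at the other end the boundary walk of the face continues with the half-edge that is next
in the rotation there. -/
def facePerm (M : G.RotationSystem) : Equiv.Perm (E(G) × Bool) :=
  flip.trans M.next

/-- The faces. A face is bounded by a closed walk, and these boundary walks are the cycles of
`facePerm`; in addition, a vertex without edges is embedded alone in a sphere, which gives one face
whose boundary walk has no edges. -/
def Face (M : G.RotationSystem) : Type (max u v) :=
  Quotient (Equiv.Perm.SameCycle.setoid M.facePerm) ⊕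
    {x : V(G) // ∀ e : β, ¬ G.Inc e (x : α)}

/-- The boundary walk of the face `f` traverses an edge starting with the half-edge `d`. -/
def Traverses (M : G.RotationSystem) (f : M.Face) (d : E(G) × Bool) : Prop :=
  f = Sum.inl (Quotient.mk (Equiv.Perm.SameCycle.setoid M.facePerm) d)

/-- The edges appearing exactly once in the boundary walk of the face `f`: the walk traverses `e`
in exactly one of its two directions. (It traverses `e` at most once in each direction.) -/
def onceInBoundary (M : G.RotationSystem) (f : M.Face) : Set E(G) :=
  {e | ∃! b : Bool, M.Traverses f (e, b)}

/-- The Euler characteristic `|V| - |E| + |F|` of the surface. -/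
noncomputable def eulerChar (M : G.RotationSystem) : ℤ :=
  (Nat.card V(G) : ℤ) - (Nat.card E(G) : ℤ) + (Nat.card M.Face : ℤ)

/-- For connected `G`: the oriented surface in which `G` is cellularly embedded is the sphere,
that is, it has genus `0`, where the genus `g` is given by `|V| - |E| + |F| = 2 - 2 g`. -/
def IsPlane (M : G.RotationSystem) : Prop :=
  M.eulerChar = 2

end RotationSystem

/-- An edge bicoloring. -/
abbrev Bicoloring {α : Type u} {β : Type v} (G : Graph α β) : Type v :=
  E(G) → Bool

open Classical in
/-- Switch the colors of the edges in `S`. -/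
noncomputable def Bicoloring.switch {α : Type u} {β : Type v} {G : Graph α β}
    (c : G.Bicoloring) (S : Set E(G)) : G.Bicoloring :=
  fun e => if e ∈ S then !(c e) else c e

/-- The edges with exactly one endpoint at the vertex `x`. -/
def nonloopsAt {α : Type u} {β : Type v} (G : Graph α β) (x : V(G)) : Set E(G) :=
  {e | G.IsNonloopAt (e : β) (x : α)}

/-- The coloring `c'` is obtained from `c` by one vertex move or one face move. -/
def RotationSystem.Move {α : Type u} {β : Type v} {G : Graph α β} (M : G.RotationSystem)
    (c c' : G.Bicoloring) : Prop :=
  (∃ x : V(G), c' = c.switch (G.nonloopsAt x)) ∨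
    ∃ f : M.Face, c' = c.switch (M.onceInBoundary f)

/-- The coloring `c'` can be obtained from `c` by a finite sequence of moves. -/
def RotationSystem.Equivalent {α : Type u} {β : Type v} {G : Graph α β}
    (M : G.RotationSystem) : G.Bicoloring → G.Bicoloring → Prop :=
  Relation.ReflTransGen M.Move

end Graph

/-!
Colorings are identified with words over `ZMod 2` indexed by the edges, so that a move adds a fixed
word: the star of a vertex, or the boundary of a face, each reduced modulo 2. The stars span the cut
space `C` (the range of `coboundary M.vert`) and the face boundaries span the range of
`coboundary M.faceOf`. A face boundary is orthogonal to every star, since its walk leaves a vertex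
as often as it enters it. The only relation between face boundaries of a connected graph is that
they sum to zero, so Euler's formula makes the dimensions agree, and the face boundaries span the
orthogonal complement `dual C` (`range_coboundary_faceOf`). Hence the classes of colorings are the
cosets of `C ⊔ dual C`, and they are as many as the elements of its orthogonal complement
`C ⊓ dual C` (`card_quotient_equivalent`).

That `|T_G(-1, -1)|` also counts `C ⊓ dual C` holds for every connected graph, plane or not. The
numbers `2 ^ (k(A) - k(E))` and `2 ^ (|A| - |V| + k(A))` count the words of `C` that vanish on `A`
and the words of `dual C` that vanish off `A`, so up to a global sign `T_G(-1, -1)` is the sum of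
`(-1) ^ |A|` over all triples of a set `A`, a word `c` of `C` that vanishes on `A`, and a word `z` of
`dual C` supported in `A`. For fixed `c` and `z`, the sum over `A` is zero unless the supports of `c`
and `z` are complementary, when it is `(-1) ^ |z|`
(`BinaryCode.sum_neg_one_pow_card_mul_indicator`). The words `z` of `dual C` whose complement lies in
`C` form a coset of `C ⊓ dual C`. It is not empty, because a word of `C ⊓ dual C` is orthogonal to
itself and so to the all-one word, which puts the all-one word into `C ⊔ dual C`; for the same reason
the sign `(-1) ^ |z|` is constant on the coset
(`BinaryCode.abs_sum_neg_one_pow_card_mul_card`).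
-/

/-! ### Binary codes and their duals -/

namespace BinaryCode

open Module Submodule

variable {ι : Type*}

/-- The words that vanish at every coordinate in `A`. -/
def vanishingOn (A : Set ι) : Submodule (ZMod 2) (ι → ZMod 2) where
  carrier := {c | ∀ i ∈ A, c i = 0}
  zero_mem' _ _ := rfl
  add_mem' hc hd i hi := by simp [hc i hi, hd i hi]
  smul_mem' a c hc i hi := by simp [hc i hi]

lemma mem_vanishingOn {A : Set ι} {c : ι → ZMod 2} :
    c ∈ vanishingOn A ↔ ∀ i ∈ A, c i = 0 :=
  Iff.rfl

/-- The nontrivial character of `ZMod 2`. -/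
def sign (a : ZMod 2) : ℤ := if a = 0 then 1 else -1

lemma prod_sign (s : Finset ι) (z : ι → ZMod 2) : ∏ i ∈ s, sign (z i) = sign (∑ i ∈ s, z i) := by
  classical
  have hadd : ∀ a b : ZMod 2, sign a * sign b = sign (a + b) := by decide
  induction s using Finset.induction_on with
  | empty => rfl
  | insert i s hi ih => rw [Finset.prod_insert hi, Finset.sum_insert hi, ih, hadd]

variable [Fintype ι]

/-- The dual of a binary linear code `C`: all words whose dot product with every word of `C` is
zero. -/
noncomputable def dual (C : Submodule (ZMod 2) (ι → ZMod 2)) : Submodule (ZMod 2) (ι → ZMod 2) :=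
  LinearMap.BilinForm.orthogonal (dotProductBilin (ZMod 2) (ZMod 2)) C

lemma mem_dual {C : Submodule (ZMod 2) (ι → ZMod 2)} {z : ι → ZMod 2} :
    z ∈ dual C ↔ ∀ c ∈ C, c ⬝ᵥ z = 0 :=
  Iff.rfl

lemma nondegenerate_dotProductBilin :
    (dotProductBilin (ZMod 2) (ZMod 2) : LinearMap.BilinForm (ZMod 2) (ι → ZMod 2)).Nondegenerate :=
  ⟨fun v h => dotProduct_eq_zero v h,
    fun v h => dotProduct_eq_zero v fun w => by rw [dotProduct_comm]; exact h w⟩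

lemma isRefl_dotProductBilin :
    (dotProductBilin (ZMod 2) (ZMod 2) : LinearMap.BilinForm (ZMod 2) (ι → ZMod 2)).IsRefl :=
  fun v w h => (dotProduct_comm w v).trans h

lemma finrank_dual (C : Submodule (ZMod 2) (ι → ZMod 2)) :
    finrank (ZMod 2) (dual C) + finrank (ZMod 2) C = Fintype.card ι := by
  have h := LinearMap.BilinForm.finrank_orthogonal
    (nondegenerate_dotProductBilin (ι := ι)) C
  have hle := C.finrank_le
  rw [finrank_fintype_fun_eq_card] at h hle
  unfold dual
  omega

lemma dual_dual (C : Submodule (ZMod 2) (ι → ZMod 2)) : dual (dual C) = C :=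
  LinearMap.BilinForm.orthogonal_orthogonal nondegenerate_dotProductBilin
    isRefl_dotProductBilin C

lemma dual_sup (C D : Submodule (ZMod 2) (ι → ZMod 2)) : dual (C ⊔ D) = dual C ⊓ dual D := by
  ext z
  simp only [mem_inf, mem_dual]
  refine ⟨fun h => ⟨fun c hc => h c (mem_sup_left hc), fun c hc => h c (mem_sup_right hc)⟩, ?_⟩
  rintro ⟨hC, hD⟩ w hw
  obtain ⟨c, hc, d, hd, rfl⟩ := mem_sup.1 hw
  rw [add_dotProduct, hC c hc, hD d hd, add_zero]

/-- A word of `C ⊓ dual C` is orthogonal to itself and so has even weight. Thus the all-one word is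
orthogonal to `C ⊓ dual C`. -/
lemma one_mem_sup_dual (C : Submodule (ZMod 2) (ι → ZMod 2)) : (1 : ι → ZMod 2) ∈ C ⊔ dual C := by
  rw [← dual_dual (C ⊔ dual C), dual_sup, dual_dual, mem_dual]
  intro b hb
  have h : b ⬝ᵥ b = 0 := hb.1 b hb.2
  rw [← h]
  refine Finset.sum_congr rfl fun i _ => ?_
  have : ∀ a : ZMod 2, a * 1 = a * a := by decide
  exact this (b i)

/-- The number of cosets of a code equals the number of words of its dual. -/
lemma card_quotient (S : Submodule (ZMod 2) (ι → ZMod 2)) :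
    Nat.card ((ι → ZMod 2) ⧸ S) = Nat.card (dual S) := by
  rw [natCard_eq_pow_finrank (K := ZMod 2), natCard_eq_pow_finrank (K := ZMod 2) (V := dual S)]
  congr 1
  have h := finrank_dual S
  have h' := S.finrank_quotient_add_finrank
  rw [finrank_fintype_fun_eq_card] at h'
  omega

lemma finrank_vanishingOn (A : Finset ι) :
    finrank (ZMod 2) (vanishingOn (A : Set ι)) + A.card = Fintype.card ι := by
  have h := (LinearMap.funLeft (ZMod 2) (ZMod 2) ((↑) : A → ι)).finrank_range_add_finrank_ker
  rw [LinearMap.range_eq_top.2 (LinearMap.funLeft_surjective_of_injective _ _ _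
    Subtype.val_injective), finrank_top, finrank_fintype_fun_eq_card,
    finrank_fintype_fun_eq_card, Fintype.card_coe] at h
  have hk : LinearMap.ker (LinearMap.funLeft (ZMod 2) (ZMod 2) ((↑) : A → ι)) =
      vanishingOn (A : Set ι) := by
    ext c
    simp [mem_vanishingOn, funext_iff, LinearMap.funLeft_apply]
  rw [hk] at h
  omega

lemma dual_vanishingOn (A : Set ι) : dual (vanishingOn A) = vanishingOn Aᶜ := by
  classical
  ext z
  rw [mem_dual, mem_vanishingOn]
  constructor
  · intro h i hi
    have := h (Pi.single i 1) fun j hj => Pi.single_eq_of_ne (fun hij : j = i => hi (hij ▸ hj)) 1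
    simpa using this
  · intro h c hc
    refine Finset.sum_eq_zero fun i _ => ?_
    by_cases hi : i ∈ A
    · rw [hc i hi, zero_mul]
    · rw [h i hi, mul_zero]

/-- The dimension of a shortened dual code in terms of a shortened code. -/
lemma finrank_dual_inf_vanishingOn_compl (C : Submodule (ZMod 2) (ι → ZMod 2)) (A : Finset ι) :
    finrank (ZMod 2) (dual C ⊓ vanishingOn (A : Set ι)ᶜ : Submodule (ZMod 2) (ι → ZMod 2)) +
        finrank (ZMod 2) C =
      A.card +
        finrank (ZMod 2) (C ⊓ vanishingOn (A : Set ι) : Submodule (ZMod 2) (ι → ZMod 2)) := by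
  rw [← dual_vanishingOn, ← dual_sup]
  have h₁ := finrank_dual (C ⊔ vanishingOn (A : Set ι))
  have h₂ := finrank_sup_add_finrank_inf_eq C (vanishingOn (A : Set ι))
  have h₃ := finrank_vanishingOn A
  omega

/-! ### An alternating sum over shortened codes -/

open Classical in
/-- The alternating sum over the sets `A` that contain the support of `z` and avoid the support of
`c` vanishes unless these two supports are complementary. -/
lemma sum_neg_one_pow_card_mul_indicator (c z : ι → ZMod 2) :
    ∑ A : Finset ι, (-1 : ℤ) ^ A.card *
        ((if c ∈ vanishingOn (A : Set ι) then 1 else 0) *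
          (if z ∈ vanishingOn (A : Set ι)ᶜ then 1 else 0)) =
      if c = z + 1 then sign (∑ i, z i) else 0 := by
  -- Both indicators are products over coordinates, so the sum factors as a product over `i` of
  -- the contributions of `i ∈ A` and `i ∉ A`.
  have hterm : ∀ A : Finset ι, (-1 : ℤ) ^ A.card *
        ((if c ∈ vanishingOn (A : Set ι) then 1 else 0) *
          (if z ∈ vanishingOn (A : Set ι)ᶜ then 1 else 0)) =
      (∏ i ∈ A, -(if c i = 0 then (1 : ℤ) else 0)) *
        ∏ i ∈ Aᶜ, (if z i = 0 then (1 : ℤ) else 0) := by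
    intro A
    rw [Finset.prod_neg, Finset.prod_boole, Finset.prod_boole, mul_assoc]
    simp [mem_vanishingOn]
  have hfactor : ∀ a b : ZMod 2, -(if a = 0 then (1 : ℤ) else 0) + (if b = 0 then 1 else 0) =
      if a = b + 1 then sign b else 0 := by decide
  rw [Finset.sum_congr rfl fun A _ => hterm A, ← Fintype.prod_add,
    Finset.prod_congr rfl fun i _ => hfactor (c i) (z i), Fintype.prod_ite_zero, prod_sign]
  simp [funext_iff]

open Classical in
lemma natCast_card_eq_sum (S : Submodule (ZMod 2) (ι → ZMod 2)) :
    (Nat.card S : ℤ) = ∑ c : ι → ZMod 2, if c ∈ S then 1 else 0 := by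
  rw [Nat.card_eq_fintype_card, Fintype.card_subtype, Finset.natCast_card_filter]

open Classical in
/-- Expanding the two cardinalities as sums over words and summing over `A` first leaves the words
of the dual whose complements lie in `C`. -/
lemma sum_neg_one_pow_card_mul_card (C : Submodule (ZMod 2) (ι → ZMod 2)) :
    ∑ A : Finset ι, (-1 : ℤ) ^ A.card *
        ((Nat.card (C ⊓ vanishingOn (A : Set ι) : Submodule (ZMod 2) (ι → ZMod 2)) : ℤ) *
          Nat.card (dual C ⊓ vanishingOn (A : Set ι)ᶜ : Submodule (ZMod 2) (ι → ZMod 2))) =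
      ∑ z : ι → ZMod 2, if z ∈ dual C ∧ z + 1 ∈ C then sign (∑ i, z i) else 0 := by
  calc
    _ = ∑ A : Finset ι, ∑ z : ι → ZMod 2, ∑ c : ι → ZMod 2,
        (if z ∈ dual C ∧ c ∈ C then (1 : ℤ) else 0) * ((-1 : ℤ) ^ A.card *
          ((if c ∈ vanishingOn (A : Set ι) then 1 else 0) *
            (if z ∈ vanishingOn (A : Set ι)ᶜ then 1 else 0))) := by
      refine Finset.sum_congr rfl fun A _ => ?_
      rw [natCast_card_eq_sum, natCast_card_eq_sum, Finset.sum_mul_sum, Finset.sum_comm,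
        Finset.mul_sum]
      refine Finset.sum_congr rfl fun z _ => ?_
      rw [Finset.mul_sum]
      refine Finset.sum_congr rfl fun c _ => ?_
      simp only [mem_inf]
      by_cases h₁ : c ∈ C <;> by_cases h₂ : z ∈ dual C <;> simp [h₁, h₂]
    _ = ∑ z : ι → ZMod 2, ∑ c : ι → ZMod 2,
        (if z ∈ dual C ∧ c ∈ C then (1 : ℤ) else 0) *
          if c = z + 1 then sign (∑ i, z i) else 0 := by
      rw [Finset.sum_comm]
      refine Finset.sum_congr rfl fun z _ => ?_
      rw [Finset.sum_comm]
      refine Finset.sum_congr rfl fun c _ => ?_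
      rw [← Finset.mul_sum, sum_neg_one_pow_card_mul_indicator]
    _ = _ := by
      refine Finset.sum_congr rfl fun z _ => ?_
      simp only [mul_ite, mul_zero, Finset.sum_ite_eq', Finset.mem_univ, if_true, ite_mul, one_mul,
        zero_mul]

/-- The words `z ∈ dual C` with `z + 1 ∈ C` form a coset of `C ⊓ dual C`, and their weights have
the same parity; hence the alternating sum counts the words of `C ⊓ dual C` up to sign. -/
theorem abs_sum_neg_one_pow_card_mul_card (C : Submodule (ZMod 2) (ι → ZMod 2)) :
    |∑ A : Finset ι, (-1 : ℤ) ^ A.card *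
        ((Nat.card (C ⊓ vanishingOn (A : Set ι) : Submodule (ZMod 2) (ι → ZMod 2)) : ℤ) *
          Nat.card (dual C ⊓ vanishingOn (A : Set ι)ᶜ : Submodule (ZMod 2) (ι → ZMod 2)))| =
      Nat.card (C ⊓ dual C : Submodule (ZMod 2) (ι → ZMod 2)) := by
  classical
  -- A decomposition `1 = c₀ + z₀` supplies the representative `z₀` of the coset.
  obtain ⟨c₀, hc₀, z₀, hz₀, h₁⟩ := mem_sup.1 (one_mem_sup_dual C)
  have hc₀' : z₀ + 1 = c₀ := by
    rw [← h₁, add_left_comm, ZModModule.add_self, add_zero]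
  have hcoset : ∀ b : ι → ZMod 2,
      (if z₀ + b ∈ dual C ∧ z₀ + b + 1 ∈ C then sign (∑ i, (z₀ + b) i) else 0) =
        sign (∑ i, z₀ i) * if b ∈ C ⊓ dual C then 1 else 0 := by
    intro b
    have hiff : (z₀ + b ∈ dual C ∧ z₀ + b + 1 ∈ C) ↔ b ∈ C ⊓ dual C := by
      rw [add_right_comm, hc₀', Submodule.add_mem_iff_right _ hz₀,
        Submodule.add_mem_iff_right _ hc₀, mem_inf, and_comm]
    rw [if_congr hiff rfl rfl]
    split_ifs with hb
    · have hb₁ : b ⬝ᵥ 1 = 0 := by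
        rw [← h₁, dotProduct_add, mem_dual.1 hz₀ b hb.1, dotProduct_comm, mem_dual.1 hb.2 c₀ hc₀,
          add_zero]
      rw [dotProduct_one] at hb₁
      simp [Finset.sum_add_distrib, hb₁]
    · simp
  rw [sum_neg_one_pow_card_mul_card,
    ← Fintype.sum_equiv (Equiv.addLeft z₀) _ _ fun b => (hcoset b).symm, ← Finset.mul_sum,
    ← natCast_card_eq_sum, abs_mul, Nat.abs_cast]
  have hsign : ∀ a : ZMod 2, |sign a| = 1 := fun a => by unfold sign; split_ifs <;> simp
  rw [hsign, one_mul]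

end BinaryCode

namespace Graph

open BinaryCode Module Submodule

/-! ### Coboundary maps modulo 2 -/

section Coboundary

variable {ε X Y : Type*}

/-- If the half-edges of the edges in `ε` are distributed to the points of `X` by `p`, this is the
map which sends a function `f` on `X` to the function on `ε` whose value at `e` is the sum of the
values of `f` at the two half-edges of `e`. For the attachment of half-edges to vertices, its range
is the cut space; for their attachment to faces, its range is the span of the face boundaries. -/
def coboundary (p : ε × Bool → X) : (X → ZMod 2) →ₗ[ZMod 2] (ε → ZMod 2) :=
  LinearMap.funLeft (ZMod 2) (ZMod 2) (fun e => p (e, false)) +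
    LinearMap.funLeft (ZMod 2) (ZMod 2) (fun e => p (e, true))

lemma coboundary_apply (p : ε × Bool → X) (f : X → ZMod 2) (e : ε) :
    coboundary p f e = f (p (e, false)) + f (p (e, true)) :=
  rfl

lemma coboundary_apply_eq_zero_iff (p : ε × Bool → X) (f : X → ZMod 2) (e : ε) :
    coboundary p f e = 0 ↔ f (p (e, false)) = f (p (e, true)) := by
  rw [coboundary_apply, CharTwo.add_eq_zero]

/-- The generators of the range of the coboundary map are the sets of edges which have exactly one
half-edge at `x`. -/
lemma coboundary_single [DecidableEq X] (p : ε × Bool → X) (x : X) (e : ε)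
    [Decidable (∃! b : Bool, p (e, b) = x)] :
    coboundary p (Pi.single x 1) e = if ∃! b : Bool, p (e, b) = x then 1 else 0 := by
  have h2 : (1 : ZMod 2) + 1 = 0 := rfl
  rw [coboundary_apply, Pi.single_apply, Pi.single_apply]
  by_cases h₀ : p (e, false) = x <;> by_cases h₁ : p (e, true) = x <;>
    simp [ExistsUnique, h₀, h₁, h2]

lemma range_coboundary_eq_span [Finite X] [DecidableEq X] (p : ε × Bool → X) :
    LinearMap.range (coboundary p) =
      span (ZMod 2) (Set.range fun x => coboundary p (Pi.single x 1)) := by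
  have := Fintype.ofFinite X
  rw [← Submodule.map_top, ← (Pi.basisFun (ZMod 2) X).span_eq, Submodule.map_span, ← Set.range_comp]
  congr 2
  ext x
  simp

/-- The coboundary maps of two attachments are orthogonal if a permutation `φ` of the half-edges
stays within the classes of one attachment, and moves each half-edge to a half-edge attached like
its opposite in the other: both halves of the sum over the half-edges agree. -/
lemma coboundary_dotProduct_coboundary [Fintype ε] (p : ε × Bool → X) (q : ε × Bool → Y)
    (φ : Equiv.Perm (ε × Bool)) (hq : ∀ d, q (φ d) = q d)
    (hp : ∀ e b, p (φ (e, b)) = p (e, !b)) (f : X → ZMod 2) (g : Y → ZMod 2) :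
    coboundary p f ⬝ᵥ coboundary q g = 0 := by
  have hφ : ∑ d : ε × Bool, f (p (φ d)) * g (q d) = ∑ d : ε × Bool, f (p d) * g (q d) := by
    rw [← Equiv.sum_comp φ fun d => f (p d) * g (q d)]
    simp only [hq]
  have hsplit : coboundary p f ⬝ᵥ coboundary q g =
      ∑ d : ε × Bool, f (p d) * g (q d) + ∑ d : ε × Bool, f (p (φ d)) * g (q d) := by
    simp only [dotProduct, coboundary_apply, Fintype.sum_prod_type, Fintype.sum_bool, hp,
      ← Finset.sum_add_distrib, Bool.not_true, Bool.not_false]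
    exact Finset.sum_congr rfl fun e _ => by ring
  rw [hsplit, hφ, CharTwo.add_self_eq_zero]

lemma finrank_range_coboundary_add [Finite X] (p : ε × Bool → X) :
    finrank (ZMod 2) (LinearMap.range (coboundary p)) +
      finrank (ZMod 2) (LinearMap.ker (coboundary p)) = Nat.card X := by
  have := Fintype.ofFinite X
  rw [LinearMap.finrank_range_add_finrank_ker, finrank_fintype_fun_eq_card,
    Nat.card_eq_fintype_card]

end Coboundary

/-! ### The cut space and the components of spanning subgraphs -/

variable {α β : Type*} {G : Graph α β}

lemma Connected.numComponents_eq_one (hG : G.Connected) : G.numComponents = 1 := by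
  obtain ⟨⟨x, hx⟩, hconn⟩ := hG
  have hreach : ∀ y (_ : Relation.ReflTransGen G.Adj x y) (hy : y ∈ V(G)),
      (Quot.mk _ ⟨x, hx⟩ : G.Component) = Quot.mk _ ⟨y, hy⟩ := by
    intro y hxy
    induction hxy with
    | refl => exact fun _ => rfl
    | tail _ hadj ih => exact fun hy => (ih hadj.left_mem).trans (Quot.sound hadj)
  refine Nat.card_eq_one_iff_exists.2 ⟨Quot.mk _ ⟨x, hx⟩, Quot.ind fun y => ?_⟩
  exact (hreach y (hconn x hx y y.2) y.2).symm

/-- In a connected graph a vertex without edges is the only vertex. -/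
lemma Connected.eq_of_not_inc (hG : G.Connected) {x : α} (hx : x ∈ V(G)) (h : ∀ e, ¬ G.Inc e x)
    {y : α} (hy : y ∈ V(G)) : x = y := by
  rcases (hG.2 x hx y hy).cases_head with rfl | ⟨z, ⟨e, he⟩, _⟩
  · rfl
  · exact absurd he.inc_left (h e)

namespace RotationSystem

variable (M : G.RotationSystem)

/-- The functions on the vertices whose coboundary vanishes on `A` are those which are constant on
the components of the spanning subgraph with edge set `A`. -/
lemma finrank_comap_coboundary_vert [Finite V(G)] (A : Set E(G)) :
    finrank (ZMod 2) ((vanishingOn A).comap (coboundary M.vert)) =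
      (G.restrict ((↑) '' A : Set β)).numComponents := by
  set H := G.restrict ((↑) '' A : Set β) with hH
  let π : V(G) → H.Component := Quot.mk _
  have hπ : Function.Surjective π := Quot.mk_surjective
  have : Finite H.Component := Finite.of_surjective π hπ
  have := Fintype.ofFinite H.Component
  have hrange : (vanishingOn A).comap (coboundary M.vert) =
      LinearMap.range (LinearMap.funLeft (ZMod 2) (ZMod 2) π) := by
    ext f
    simp only [mem_comap, mem_vanishingOn, coboundary_apply_eq_zero_iff, LinearMap.mem_range]
    constructor
    · intro hf
      refine ⟨Quot.lift f ?_, rfl⟩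
      rintro x y ⟨e, he, hxy⟩
      obtain ⟨e, heA, rfl⟩ := he
      rcases (M.isLink e).eq_and_eq_or_eq_and_eq hxy with ⟨h₀, h₁⟩ | ⟨h₀, h₁⟩
      · rw [← Subtype.ext h₀, ← Subtype.ext h₁, hf e heA]
      · rw [← Subtype.ext h₀, ← Subtype.ext h₁, hf e heA]
    · rintro ⟨g, rfl⟩ e he
      exact congrArg g (Quot.sound ⟨e, ⟨e, he, rfl⟩, M.isLink e⟩)
  rw [hrange, LinearMap.finrank_range_of_inj (LinearMap.funLeft_injective_of_surjective _ _ _ hπ),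
    finrank_fintype_fun_eq_card, numComponents, Nat.card_eq_fintype_card]

lemma finrank_ker_coboundary_vert [Finite V(G)] :
    finrank (ZMod 2) (LinearMap.ker (coboundary M.vert)) = G.numComponents := by
  have h := M.finrank_comap_coboundary_vert Set.univ
  rw [Set.image_univ, Subtype.range_coe, restrict_self] at h
  have hker : LinearMap.ker (coboundary M.vert) =
      (vanishingOn Set.univ).comap (coboundary M.vert) := by
    ext f
    simp [mem_vanishingOn, funext_iff]
  rw [hker, h]

/-- The cuts that avoid `A` form a space of dimension `k(A) - k(G)`. -/
lemma finrank_range_coboundary_vert_inf [Finite V(G)] (A : Set E(G)) :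
    finrank (ZMod 2) (LinearMap.range (coboundary M.vert) ⊓ vanishingOn A :
        Submodule (ZMod 2) (E(G) → ZMod 2)) + G.numComponents =
      (G.restrict ((↑) '' A : Set β)).numComponents := by
  have hle : LinearMap.ker (coboundary M.vert) ≤ (vanishingOn A).comap (coboundary M.vert) :=
    LinearMap.ker_le_comap _
  have h := ((coboundary M.vert).domRestrict
    ((vanishingOn A).comap (coboundary M.vert))).finrank_range_add_finrank_ker
  rwa [LinearMap.range_domRestrict, LinearMap.ker_domRestrict,
    (Submodule.comapSubtypeEquivOfLe hle).finrank_eq, Submodule.map_comap_eq,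
    M.finrank_comap_coboundary_vert, M.finrank_ker_coboundary_vert] at h

/-! ### The face space of a plane graph -/

/-- The face whose boundary walk contains the half-edge `d`. -/
def faceOf (d : E(G) × Bool) : M.Face :=
  Sum.inl (Quotient.mk (Equiv.Perm.SameCycle.setoid M.facePerm) d)

lemma faceOf_facePerm (d : E(G) × Bool) : M.faceOf (M.facePerm d) = M.faceOf d :=
  congrArg Sum.inl (Quotient.sound (Equiv.Perm.sameCycle_apply_left.2 (.refl _ _)))

lemma vert_next (d : E(G) × Bool) : M.vert (M.next d) = M.vert d :=
  (M.sameCycle_next_iff _ _).1 (Equiv.Perm.sameCycle_apply_left.2 (.refl _ _))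

lemma facePerm_apply (e : E(G)) (b : Bool) : M.facePerm (e, b) = M.next (e, !b) :=
  rfl

lemma vert_facePerm (e : E(G)) (b : Bool) : M.vert (M.facePerm (e, b)) = M.vert (e, !b) :=
  M.vert_next _

lemma range_coboundary_faceOf_le [Fintype E(G)] :
    LinearMap.range (coboundary M.faceOf) ≤ dual (LinearMap.range (coboundary M.vert)) := by
  rintro _ ⟨g, rfl⟩ _ ⟨f, rfl⟩
  exact coboundary_dotProduct_coboundary M.vert M.faceOf M.facePerm M.faceOf_facePerm
    M.vert_facePerm f g

/-- A function on the half-edges which is invariant under the rotation and takes the same value at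
the two half-edges of every edge is constant if the graph is connected. -/
lemma eq_of_invariant (hG : G.Connected) {X : Type*} {g : E(G) × Bool → X}
    (hnext : ∀ d, g (M.next d) = g d) (hflip : ∀ e, g (e, false) = g (e, true))
    (d d' : E(G) × Bool) : g d = g d' := by
  have hvert : ∀ d d', M.vert d = M.vert d' → g d = g d' := by
    intro d d' h
    obtain ⟨n, rfl⟩ := (M.sameCycle_next_iff d d').2 h
    have hzpow : ∀ n : ℤ, ∀ x, g ((M.next ^ n) x) = g x := by
      intro n
      induction n using Int.induction_on with
      | zero => exact fun _ => rfl
      | succ n ih => intro x; rw [zpow_add_one, Equiv.Perm.mul_apply, ih, hnext]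
      | pred n ih =>
        intro x
        rw [zpow_sub_one, Equiv.Perm.mul_apply, ih]
        simpa using (hnext (M.next⁻¹ x)).symm
    exact (hzpow n d).symm
  have hreach : ∀ y, Relation.ReflTransGen G.Adj (M.vert d) y →
      ∀ d', (M.vert d' : α) = y → g d = g d' := by
    intro y hy
    induction hy with
    | refl => exact fun d' h => hvert d d' (Subtype.ext h.symm)
    | tail _ hadj ih =>
      intro d' hd'
      obtain ⟨e, he⟩ := hadj
      rcases (M.isLink ⟨e, he.edge_mem⟩).eq_and_eq_or_eq_and_eq he with ⟨h₀, h₁⟩ | ⟨h₀, h₁⟩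
      · rw [ih _ h₀, hflip]
        exact hvert _ _ (Subtype.ext (h₁.trans hd'.symm))
      · rw [ih _ h₁, ← hflip]
        exact hvert _ _ (Subtype.ext (h₀.trans hd'.symm))
  exact hreach _ (hG.2 _ (M.vert d).2 _ (M.vert d').2) d' rfl

/-- A function on the faces with zero coboundary takes the same value on the two sides of every
edge, and so it is constant if the graph is connected. -/
lemma eq_of_coboundary_faceOf_eq_zero (hG : G.Connected) {g : M.Face → ZMod 2}
    (hg : coboundary M.faceOf g = 0) (f f' : M.Face) : g f = g f' := by
  have hflip : ∀ e, g (M.faceOf (e, false)) = g (M.faceOf (e, true)) := fun e =>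
    (coboundary_apply_eq_zero_iff _ _ _).1 (congrFun hg e)
  have hnext : ∀ d, g (M.faceOf (M.next d)) = g (M.faceOf d) := by
    rintro ⟨e, b⟩
    -- In the walk of a face, `M.next (e, b)` follows the half-edge opposite to `(e, b)`.
    have h : M.faceOf (M.next (e, b)) = M.faceOf (e, !b) := by
      rw [← M.faceOf_facePerm (e, !b), facePerm_apply, Bool.not_not]
    rw [h]
    cases b
    · exact (hflip e).symm
    · exact hflip e
  have hisolated : ∀ x : {x : V(G) // ∀ e : β, ¬ G.Inc e (x : α)}, ∀ d : E(G) × Bool, False := by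
    rintro ⟨x, hx⟩ ⟨e, b⟩
    refine hx e ?_
    rw [hG.eq_of_not_inc x.2 hx (M.vert (e, false)).2]
    exact (M.isLink e).inc_left
  rcases f with f | f <;> rcases f' with f' | f'
  · induction f using Quotient.ind with | _ d
    induction f' using Quotient.ind with | _ d'
    exact M.eq_of_invariant (g := fun d => g (M.faceOf d)) hG hnext hflip d d'
  · induction f using Quotient.ind with | _ d
    exact (hisolated f' d).elim
  · induction f' using Quotient.ind with | _ d
    exact (hisolated f d).elim
  · rw [Subtype.ext (Subtype.ext (hG.eq_of_not_inc f.1.2 f.2 f'.1.2))]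

instance [Finite V(G)] [Finite E(G)] : Finite M.Face :=
  inferInstanceAs (Finite (_ ⊕ _))

/-- For a plane graph the face boundaries span the orthogonal complement of the cut space: they are
orthogonal to the cuts, and the dimensions agree by Euler's formula. -/
theorem range_coboundary_faceOf [Finite V(G)] [Fintype E(G)] (hG : G.Connected)
    (hM : M.IsPlane) :
    LinearMap.range (coboundary M.faceOf) = dual (LinearMap.range (coboundary M.vert)) := by
  refine eq_of_le_of_finrank_le M.range_coboundary_faceOf_le ?_
  have hker : finrank (ZMod 2) (LinearMap.ker (coboundary M.faceOf)) ≤ 1 := by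
    have hone : (1 : M.Face → ZMod 2) ∈ LinearMap.ker (coboundary M.faceOf) := by
      rw [LinearMap.mem_ker]
      exact funext fun e => CharTwo.add_self_eq_zero _
    refine finrank_le_one ⟨1, hone⟩ fun g => ?_
    by_cases hF : Nonempty M.Face
    · obtain ⟨f⟩ := hF
      refine ⟨g.1 f, Subtype.ext (funext fun f' => ?_)⟩
      simpa using M.eq_of_coboundary_faceOf_eq_zero hG g.2 f f'
    · exact ⟨0, Subtype.ext (funext fun f' => (hF ⟨f'⟩).elim)⟩
  have h₁ := finrank_range_coboundary_add M.faceOf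
  have h₂ := finrank_range_coboundary_add M.vert
  have h₃ := finrank_dual (LinearMap.range (coboundary M.vert))
  rw [finrank_ker_coboundary_vert, hG.numComponents_eq_one] at h₂
  have h₄ : M.eulerChar = 2 := hM
  rw [eulerChar, Nat.card_eq_fintype_card (α := E(G))] at h₄
  omega

end RotationSystem

/-! ### Bicolorings as binary words -/

/-- The bijection that sends `true` to `1` and `false` to `0`. -/
def boolEquivZMod : Bool ≃ ZMod 2 where
  toFun b := if b then 1 else 0
  invFun a := a == 1
  left_inv := by decide
  right_inv := by decide

/-- A bicoloring as a word over `ZMod 2`. -/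
def Bicoloring.toWord : G.Bicoloring ≃ (E(G) → ZMod 2) :=
  Equiv.piCongrRight fun _ => boolEquivZMod

open Classical in
/-- Switching the colors of the edges in `S` adds the indicator of `S`. -/
lemma Bicoloring.toWord_switch (c : G.Bicoloring) (S : Set E(G)) :
    toWord (c.switch S) = toWord c + fun e => if e ∈ S then 1 else 0 := by
  have hnot : ∀ b, boolEquivZMod (!b) = boolEquivZMod b + 1 := by decide
  funext e
  change boolEquivZMod (if e ∈ S then !(c e) else c e) =
    boolEquivZMod (c e) + if e ∈ S then 1 else 0
  split_ifs
  · exact hnot _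
  · exact (add_zero _).symm

namespace RotationSystem

variable (M : G.RotationSystem)

lemma mem_nonloopsAt_iff (x : V(G)) (e : E(G)) :
    e ∈ G.nonloopsAt x ↔ ∃! b : Bool, M.vert (e, b) = x := by
  have hlink := M.isLink e
  constructor
  · rintro ⟨y, hyx, hxy⟩
    rcases hlink.eq_and_eq_or_eq_and_eq hxy with ⟨h₀, h₁⟩ | ⟨h₀, h₁⟩
    · refine ⟨false, Subtype.ext h₀, ?_⟩
      rintro (_ | _) h
      · rfl
      · exact absurd (h₁.symm.trans (congrArg Subtype.val h)) hyx
    · refine ⟨true, Subtype.ext h₁, ?_⟩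
      rintro (_ | _) h
      · exact absurd (h₀.symm.trans (congrArg Subtype.val h)) hyx
      · rfl
  · rintro ⟨_ | _, rfl, hb⟩
    · exact ⟨M.vert (e, true), fun h => by simpa using hb true (Subtype.ext h), hlink⟩
    · exact ⟨M.vert (e, false), fun h => by simpa using hb false (Subtype.ext h), hlink.symm⟩

lemma mem_onceInBoundary_iff (f : M.Face) (e : E(G)) :
    e ∈ M.onceInBoundary f ↔ ∃! b : Bool, M.faceOf (e, b) = f :=
   existsUnique_congr fun _ => eq_comm

open Classical in
/-- The words by which the moves change a bicoloring. -/
noncomputable def moveWords : Set (E(G) → ZMod 2) :=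
  (Set.range fun x => coboundary M.vert (Pi.single x 1)) ∪
    Set.range fun f => coboundary M.faceOf (Pi.single f 1)

lemma move_iff (c c' : G.Bicoloring) :
    M.Move c c' ↔ ∃ w ∈ M.moveWords, c'.toWord = c.toWord + w := by
  classical
  have hvert : ∀ x, (fun e => if e ∈ G.nonloopsAt x then (1 : ZMod 2) else 0) =
      coboundary M.vert (Pi.single x 1) := fun x => funext fun e => by
    rw [coboundary_single, if_congr (M.mem_nonloopsAt_iff x e) rfl rfl]
  have hface : ∀ f, (fun e => if e ∈ M.onceInBoundary f then (1 : ZMod 2) else 0) =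
      coboundary M.faceOf (Pi.single f 1) := fun f => funext fun e => by
    rw [coboundary_single, if_congr (M.mem_onceInBoundary_iff f e) rfl rfl]
  simp only [Move, moveWords, Set.mem_union, or_and_right, exists_or, Set.exists_range_iff,
    ← Bicoloring.toWord.apply_eq_iff_eq (y := c.switch _), Bicoloring.toWord_switch]
  simp only [← hvert, ← hface]

lemma equivalent_iff (c c' : G.Bicoloring) :
    M.Equivalent c c' ↔ c.toWord - c'.toWord ∈ span (ZMod 2) M.moveWords := by
  constructor
  · intro h
    induction h with
    | refl => simp
    | tail _ hmove ih =>
      obtain ⟨w, hw, h⟩ := (M.move_iff _ _).1 hmove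
      rw [h, ← sub_sub]
      exact sub_mem ih (subset_span hw)
  · have key : ∀ w ∈ span (ZMod 2) M.moveWords, ∀ c c' : G.Bicoloring,
        c'.toWord = c.toWord + w → M.Equivalent c c' := by
      intro w hw
      induction hw using span_induction with
      | mem w hw => exact fun c c' h => .single ((M.move_iff _ _).2 ⟨w, hw, h⟩)
      | zero =>
        intro c c' h
        rw [add_zero, Bicoloring.toWord.apply_eq_iff_eq] at h
        exact h ▸ .refl
      | add v w _ _ hv hw =>
        intro c c' h
        refine (hv c (Bicoloring.toWord.symm (c.toWord + v)) (by simp)).trans (hw _ _ ?_)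
        rw [h, Equiv.apply_symm_apply, add_assoc]
      | smul a w _ hw =>
        intro c c' h
        have hbit : ∀ a : ZMod 2, a = 0 ∨ a = 1 := by decide
        rcases hbit a with rfl | rfl
        · rw [zero_smul, add_zero, Bicoloring.toWord.apply_eq_iff_eq] at h
          exact h ▸ .refl
        · exact hw c c' (by rwa [one_smul] at h)
    intro h
    refine key _ h c c' ?_
    rw [← ZModModule.sub_eq_add, sub_sub_cancel]

lemma equivalence_equivalent : Equivalence M.Equivalent where
  refl _ := .refl
  symm {c c'} h := by
    rw [equivalent_iff] at h ⊢
    rw [← neg_sub]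
    exact neg_mem h
  trans := Relation.ReflTransGen.trans

lemma span_moveWords [Finite V(G)] [Finite E(G)] :
    span (ZMod 2) M.moveWords =
      LinearMap.range (coboundary M.vert) ⊔ LinearMap.range (coboundary M.faceOf) := by
  classical
  rw [moveWords, span_union, range_coboundary_eq_span, range_coboundary_eq_span]

/-- In a plane graph the classes of bicolorings are the cosets of the sum of the cut space and its
orthogonal complement, so they are as many as the bicycles. -/
theorem card_quotient_equivalent [Finite V(G)] [Fintype E(G)] (hG : G.Connected)
    (hM : M.IsPlane) :
    Nat.card (Quotient (Setoid.mk M.Equivalent M.equivalence_equivalent)) =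
      Nat.card (LinearMap.range (coboundary M.vert) ⊓ dual (LinearMap.range (coboundary M.vert)) :
        Submodule (ZMod 2) (E(G) → ZMod 2)) := by
  have hcard : Nat.card (Quotient (Setoid.mk M.Equivalent M.equivalence_equivalent)) =
      Nat.card ((E(G) → ZMod 2) ⧸ span (ZMod 2) M.moveWords) :=
    Nat.card_congr (Quotient.congr Bicoloring.toWord fun c c' =>
      (M.equivalent_iff c c').trans (quotientRel_def _).symm)
  rw [hcard, card_quotient, span_moveWords, M.range_coboundary_faceOf hG hM, dual_sup, dual_dual,
    inf_comm]

/-! ### The Tutte polynomial at `(-1, -1)` -/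

/-- The summands of the Tutte polynomial at `(-1, -1)` count pairs of a cut avoiding `A` and an
even subgraph contained in `A`, up to a sign which depends only on the parities of `|A|` and
`|V(G)|`. -/
lemma tuttePolynomial_summand [Finite V(G)] [Fintype E(G)] (hG : G.Connected) (A : Finset E(G)) :
    (-2 : ℤ) ^ ((G.restrict ((↑) '' (A : Set E(G)) : Set β)).numComponents - G.numComponents) *
      (-2) ^ (A.card + (G.restrict ((↑) '' (A : Set E(G)) : Set β)).numComponents - V(G).ncard) =
    (-1) ^ (V(G).ncard + 1) * ((-1) ^ A.card *
      ((Nat.card (LinearMap.range (coboundary M.vert) ⊓ vanishingOn (A : Set E(G)) :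
          Submodule (ZMod 2) (E(G) → ZMod 2)) : ℤ) *
        Nat.card (dual (LinearMap.range (coboundary M.vert)) ⊓ vanishingOn (A : Set E(G))ᶜ :
          Submodule (ZMod 2) (E(G) → ZMod 2)))) := by
  have h₁ := M.finrank_range_coboundary_vert_inf (A : Set E(G))
  have h₂ := finrank_dual_inf_vanishingOn_compl (LinearMap.range (coboundary M.vert)) A
  have h₃ := finrank_range_coboundary_add M.vert
  rw [finrank_ker_coboundary_vert, hG.numComponents_eq_one, Nat.card_coe_set_eq] at h₃
  rw [hG.numComponents_eq_one] at h₁ ⊢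
  rw [natCard_eq_pow_finrank (K := ZMod 2), Nat.card_zmod,
    natCard_eq_pow_finrank (K := ZMod 2)
      (V := (dual _ ⊓ vanishingOn (A : Set E(G))ᶜ : Submodule (ZMod 2) (E(G) → ZMod 2))),
    Nat.card_zmod]
  generalize (G.restrict ((↑) '' (A : Set E(G)) : Set β)).numComponents = k at *
  generalize finrank (ZMod 2) (LinearMap.range (coboundary M.vert) ⊓ vanishingOn (A : Set E(G)) :
    Submodule (ZMod 2) (E(G) → ZMod 2)) = a at *
  generalize finrank (ZMod 2) (dual (LinearMap.range (coboundary M.vert)) ⊓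
    vanishingOn (A : Set E(G))ᶜ : Submodule (ZMod 2) (E(G) → ZMod 2)) = b at *
  -- The dimensions satisfy `b + |V(G)| = |A| + a + 1`, which fixes the parity of `a + b` and shows
  -- that no subtraction in the exponents truncates.
  have hsign : (-1 : ℤ) ^ (a + b) = (-1) ^ (V(G).ncard + 1 + A.card) := by
    refine neg_one_pow_congr ?_
    rw [Nat.even_iff, Nat.even_iff]
    omega
  have ha : k - 1 = a := by omega
  have hb : A.card + k - V(G).ncard = b := by omega
  rw [ha, hb, ← mul_assoc, ← pow_add, ← pow_add (-1), ← hsign, neg_pow (2 : ℤ)]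
  push_cast
  ring

theorem abs_eval_tuttePolynomial [Finite V(G)] [Fintype E(G)] (hE : E(G).Finite)
    (hG : G.Connected) :
    |MvPolynomial.eval ![-1, -1] (G.tuttePolynomial hE)| =
      Nat.card (LinearMap.range (coboundary M.vert) ⊓ dual (LinearMap.range (coboundary M.vert)) :
        Submodule (ZMod 2) (E(G) → ZMod 2)) := by
  classical
  have heval : MvPolynomial.eval ![-1, -1] (G.tuttePolynomial hE) =
      ∑ F ∈ hE.toFinset.powerset,
        (-2 : ℤ) ^ ((G.restrict (F : Set β)).numComponents - G.numComponents) *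
          (-2) ^ (F.card + (G.restrict (F : Set β)).numComponents - V(G).ncard) := by
    rw [tuttePolynomial, map_sum]
    refine Finset.sum_congr rfl fun F _ => ?_
    norm_num
  have hreindex : ∑ F ∈ hE.toFinset.powerset,
        (-2 : ℤ) ^ ((G.restrict (F : Set β)).numComponents - G.numComponents) *
          (-2) ^ (F.card + (G.restrict (F : Set β)).numComponents - V(G).ncard) =
      ∑ A : Finset E(G),
        (-2 : ℤ) ^ ((G.restrict ((↑) '' (A : Set E(G)) : Set β)).numComponents -
            G.numComponents) *
          (-2) ^ (A.card + (G.restrict ((↑) '' (A : Set E(G)) : Set β)).numComponents -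
            V(G).ncard) := by
    symm
    refine Finset.sum_bij (fun A _ => A.map (Function.Embedding.subtype _)) ?_ ?_ ?_ ?_
    · intro A _
      rw [Finset.mem_powerset]
      intro e he
      obtain ⟨e, -, rfl⟩ := Finset.mem_map.1 he
      exact hE.mem_toFinset.2 e.2
    · exact fun A _ B _ h => Finset.map_injective _ h
    · intro F hF
      refine ⟨F.subtype (· ∈ E(G)), Finset.mem_univ _, Finset.subtype_map_of_mem fun e he => ?_⟩
      exact hE.mem_toFinset.1 (Finset.mem_powerset.1 hF he)
    · intro A _
      rw [Finset.card_map, Finset.coe_map]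
      rfl
  rw [heval, hreindex, Finset.sum_congr rfl fun A _ => M.tuttePolynomial_summand hG A,
    ← Finset.mul_sum, abs_mul, abs_neg_one_pow, one_mul, abs_sum_neg_one_pow_card_mul_card]

end RotationSystem

end Graph

theorem mainTheorem2 {α β : Type*} (G : Graph α β) (hV : V(G).Finite) (hE : E(G).Finite)
    (hG : G.Connected) (M : G.RotationSystem) (hM : M.IsPlane) :
    ∃ h : Equivalence M.Equivalent,
      (Nat.card (Quotient (Setoid.mk M.Equivalent h)) : ℤ) =
        |MvPolynomial.eval ![-1, -1] (G.tuttePolynomial hE)| := by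
  have := hV.to_subtype
  have := hE.fintype
  exact ⟨M.equivalence_equivalent, by
    rw [M.abs_eval_tuttePolynomial hE hG, M.card_quotient_equivalent hG hM]⟩
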